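/- Let $A$ be a finite alphabet, $p\ge 2$, and let $\tau:A\to A^p$ be a substitution of constant length $p$, extended by concatenation to finite words and to $A^{\mathbb Z}$ (with $\tau(x_0)$ starting at coordinate $0$). Assume that $\tau$ is primitive, i.e. there is $n\ge 0$ such that every letter $a$ occurs in $\tau^n(b)$ for every letter $b$. Let $T$ be the shift on $A^{\mathbb Z}$, $(Tx)_i=x_{i+1}$, and let $X_\tau\subseteq A^{\mathbb Z}$ be the smallest closed set with $TX_\tau=X_\tau$ in which all words $\tau^n(a)$ ($n\ge 0$, $a\in A$) appear. Assume that $X_\tau$ is infinite. Then for each $x\in X_\tau$ there is a unique sequence $\pi(x)=(\delta_i)_{i\ge 0}\in\{0,\dots,p-1\}^{\mathbb N}$ for which there exist points $x^{(i)}\in X_\tau$ with $x^{(0)}=x$ and $\tau(x^{(i+1)})=T^{-\delta_i}x^{(i)}$ for all $i\ge 0$ (a known theorem of Dekking and Mossé, recalled here only to define $\pi$); through base-$p$ expansions, $\pi$ is the factor map of $X_\tau$ onto the $p$-odometer. **Proposition 3.3.** If $\tau$ has overall coincidences, that is, for all $a,b\in A$ there is $i\in\{0,\dots,p-1\}$ with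 $\tau(a)_i=\tau(b)_i$, then any two distinct points $x,y\in X_\tau$ with $\pi(x)=\pi(y)$ form a proximal pair: for every metric $\rho$ on $X_\tau$ inducing its topology (the subspace topology from the product of the discrete topologies), $$\liminf_{n\to\infty}\rho(T^nx,T^ny)=0 .$$ -/

import Mathlib

namespace ConstSubst

/-- The power `T ^ k` (`k ∈ ℤ`) of the two-sided shift on `A ^ ℤ`: `(T ^ k x)_n = x_{n + k}`. -/
def shiftPow {A : Type*} (k : ℤ) (x : ℤ → A) : ℤ → A := fun n => x (n + k)

/-- The two-sided shift map `T`: `(T x)_n = x_{n + 1}`. -/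
def shift {A : Type*} (x : ℤ → A) : ℤ → A := fun n => x (n + 1)

/-- A two-sided subshift: a closed subset `X` of `A ^ ℤ` (product of the discrete topologies)
with `T X = X`. -/
def IsSubshift {A : Type*} [TopologicalSpace A] (X : Set (ℤ → A)) : Prop :=
  IsClosed X ∧ shift '' X = X

/-- The finite word `w` is a sub-word of the two-sided sequence `x`. -/
def Occurs {A : Type*} (w : List A) (x : ℤ → A) : Prop :=
  ∃ k : ℤ, ∀ (i : ℕ) (hi : i < w.length), x (k + i) = w[i]

/-- A word appears in a set of sequences if it is a sub-word of one of its points. -/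
def AppearsIn {A : Type*} (w : List A) (X : Set (ℤ → A)) : Prop :=
  ∃ x ∈ X, Occurs w x

/-! A substitution of constant length `p` on the alphabet `A` is a map `τ : A → Fin p → A`, the
image of the letter `a` being the word `τ a 0, …, τ a (p - 1)`. -/

/-- Extension of a substitution to finite words, by concatenation. -/
def substWord {A : Type*} {p : ℕ} (τ : A → Fin p → A) (w : List A) : List A :=
  w.flatMap fun a => List.ofFn (τ a)

/-- The word `τ ^ n (a)`. -/
def iterWord {A : Type*} {p : ℕ} (τ : A → Fin p → A) (n : ℕ) (a : A) : List A :=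
  (substWord τ)^[n] [a]

/-- Extension of a substitution to two-sided sequences, by concatenation, the word `τ (x_0)`
starting at coordinate `0`: the letter at coordinate `p * k + i`, `0 ≤ i < p`, is the `i`-th letter
of `τ (x_k)`. -/
def substSeq {A : Type*} {p : ℕ} [NeZero p] (τ : A → Fin p → A) (x : ℤ → A) : ℤ → A :=
  fun n => τ (x (n / p)) (Fin.ofNat p (n % p).toNat)

/-- Primitivity: for some `n`, every letter `a` appears in every word `τ ^ n (b)`. -/
def IsPrimitive {A : Type*} {p : ℕ} (τ : A → Fin p → A) : Prop :=
  ∃ n : ℕ, ∀ a b : A, a ∈ iterWord τ n b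

/-- Two words of the same length have a coincidence if they agree at some coordinate. -/
def HaveCoincidence {A : Type*} {n : ℕ} (u v : Fin n → A) : Prop :=
  ∃ i : Fin n, u i = v i

/-- The images of any two letters have a coincidence. -/
def HasOverallCoincidences {A : Type*} {p : ℕ} (τ : A → Fin p → A) : Prop :=
  ∀ a b : A, HaveCoincidence (τ a) (τ b)

/-- `X_τ`: the smallest subshift of `A ^ ℤ` in which all the words `τ ^ n (a)` appear. -/
def substShift {A : Type*} [TopologicalSpace A] {p : ℕ} (τ : A → Fin p → A) : Set (ℤ → A) :=
  ⋂₀ {X | IsSubshift X ∧ ∀ (n : ℕ) (a : A), AppearsIn (iterWord τ n a) X}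

theorem shift_mem_substShift {A : Type*} [TopologicalSpace A] {p : ℕ} (τ : A → Fin p → A)
    {x : ℤ → A} (hx : x ∈ substShift τ) : shift x ∈ substShift τ := by
  intro X hX
  rw [← hX.1.2]
  exact ⟨x, hx X hX, rfl⟩

/-- The action on `X_τ`: the restriction of the shift. -/
def shiftOn {A : Type*} [TopologicalSpace A] {p : ℕ} (τ : A → Fin p → A)
    (x : substShift τ) : substShift τ :=
  ⟨shift x.1, shift_mem_substShift τ x.2⟩

/-- `δ ∈ {0, …, p - 1} ^ ℕ` is an odometer address of `x ∈ X_τ`: there are points `x^(i)` of `X_τ`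
with `x^(0) = x` and `τ (x^(i+1)) = T ^ (-δ_i) x^(i)` for all `i`. -/
def IsAddress {A : Type*} [TopologicalSpace A] {p : ℕ} [NeZero p] (τ : A → Fin p → A)
    (x : substShift τ) (δ : ℕ → Fin p) : Prop :=
  ∃ z : ℕ → substShift τ, z 0 = x ∧
    ∀ i : ℕ, substSeq τ (z (i + 1)).1 = shiftPow (-((δ i : ℕ) : ℤ)) (z i).1

/-- The factor map `π` from `X_τ` to the `p`-odometer, the latter identified with
`{0, …, p - 1} ^ ℕ` through expansion in base `p`: `π x` is the address of `x` (there is exactly one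
if `τ` is primitive and `X_τ` is infinite). -/
noncomputable def odometerMap {A : Type*} [TopologicalSpace A] {p : ℕ} [NeZero p]
    (τ : A → Fin p → A) (x : substShift τ) : ℕ → Fin p :=
  Classical.epsilon fun δ => IsAddress τ x δ

/-- Proximality of the pair `x, y` for the map `T` and the distance `ρ`:
`liminf ρ (T ^ n x, T ^ n y) = 0` as `n → +∞`. -/
def IsProximalPair {X : Type*} (ρ : X → X → ℝ) (T : X → X) (x y : X) : Prop :=
  Filter.liminf (fun n : ℕ => ρ (T^[n] x) (T^[n] y)) Filter.atTop = 0

end ConstSubst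

namespace ConstSubst

open Filter

variable {A : Type*} {p : ℕ}

/-! ### Shifts, iterates of the substitution, and the words they produce. -/

section Combinatorics

/-! Unrolling a common address of `x` and `y` for `m + 1` steps exhibits both points as the same
shift of `τ ^ (m + 1) (u)` and `τ ^ (m + 1) (v)`. For every coordinate `k` the words `τ (u_k)` and
`τ (v_k)` share a letter at some position, and `τ ^ m` inflates it to a block of length `p ^ m` on
which `x` and `y` agree. As `k` is free, such blocks occur arbitrarily far to the right; by
compactness, agreement on a long central window means a small distance, whatever the metric
(`exists_long_coincidence`, `exists_forall_mem_dist_lt`).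

Since `odometerMap` is a choice, its value must be shown to be an address. Only existence is needed:
`X_τ` is identified with the language shift, and the shifts of `τ`-images of its points form a
subshift containing all words `τ ^ n (a)`, so minimality of `X_τ` allows desubstitution
(`exists_desubstitution`). -/

theorem shiftPow_shiftPow (j k : ℤ) (x : ℤ → A) :
    shiftPow j (shiftPow k x) = shiftPow (j + k) x := by
  funext n
  simp only [shiftPow, add_assoc]

theorem shiftPow_zero (x : ℤ → A) : shiftPow 0 x = x := by
  funext n
  simp only [shiftPow, add_zero]

theorem shift_eq_shiftPow (x : ℤ → A) : shift x = shiftPow 1 x := rfl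


theorem shift_iterate (n : ℕ) (x : ℤ → A) : shift^[n] x = shiftPow n x := by
  induction n with
  | zero => simp [shiftPow_zero]
  | succ n ih =>
    rw [Function.iterate_succ_apply', ih]
    funext m
    simp only [shift, shiftPow]
    push_cast
    congr 1
    ring

theorem continuous_shiftPow [TopologicalSpace A] (k : ℤ) :
    Continuous (shiftPow k : (ℤ → A) → ℤ → A) :=
  continuous_pi fun n => continuous_apply (n + k)

theorem isSubshift_of_shiftPow_mem [TopologicalSpace A] {X : Set (ℤ → A)} (hX : IsClosed X)
    (h : ∀ x ∈ X, ∀ k : ℤ, shiftPow k x ∈ X) : IsSubshift X := by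
  refine ⟨hX, Set.Subset.antisymm ?_ fun x hx => ⟨shiftPow (-1) x, h x hx _, ?_⟩⟩
  · rintro _ ⟨x, hx, rfl⟩
    exact h x hx 1
  · rw [shift_eq_shiftPow, shiftPow_shiftPow, add_neg_cancel, shiftPow_zero]

theorem IsSubshift.shiftPow_mem [TopologicalSpace A] {X : Set (ℤ → A)} (hX : IsSubshift X)
    {x : ℤ → A} (hx : x ∈ X) (k : ℤ) : shiftPow k x ∈ X := by
  induction k using Int.induction_on with
  | zero => rwa [shiftPow_zero]
  | succ k ih =>
    rw [add_comm, ← shiftPow_shiftPow, ← hX.2]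
    exact ⟨_, ih, rfl⟩
  | pred k ih =>
    rw [← hX.2] at ih
    obtain ⟨y, hy, hyx⟩ := ih
    rw [sub_eq_neg_add, ← shiftPow_shiftPow, ← hyx, shift_eq_shiftPow, shiftPow_shiftPow,
      neg_add_cancel, shiftPow_zero]
    exact hy

variable (τ : A → Fin p → A)

theorem length_substWord (w : List A) : (substWord τ w).length = p * w.length := by
  induction w with
  | nil => simp [substWord]
  | cons a w ih =>
    have : substWord τ (a :: w) = List.ofFn (τ a) ++ substWord τ w := by simp [substWord]
    rw [this, List.length_append, ih, List.length_ofFn, List.length_cons]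
    ring

theorem length_iterWord (n : ℕ) (a : A) : (iterWord τ n a).length = p ^ n := by
  induction n with
  | zero => simp [iterWord]
  | succ n ih =>
    unfold iterWord at ih ⊢
    rw [Function.iterate_succ_apply', length_substWord, ih, pow_succ, mul_comm]

variable [NeZero p]

theorem substSeq_mul_add (x : ℤ → A) (k : ℤ) (i : ℕ) (hi : i < p) :
    substSeq τ x (p * k + i) = τ (x k) ⟨i, hi⟩ := by
  have h0 : (0 : ℤ) < p := by exact_mod_cast Nat.pos_of_ne_zero (NeZero.ne p)
  have h1 : ((p : ℤ) * k + i) / p = k := by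
    rw [Int.mul_add_ediv_left _ _ h0.ne', Int.ediv_eq_zero_of_lt (by positivity) (by omega),
      add_zero]
  have h2 : ((p : ℤ) * k + i) % p = i := by
    rw [Int.mul_add_emod_self_left]
    exact Int.emod_eq_of_lt (by positivity) (by omega)
  unfold substSeq
  rw [h1, h2]
  congr 1
  ext
  simp [Fin.ofNat, Nat.mod_eq_of_lt hi]

theorem substSeq_shiftPow (k : ℤ) (x : ℤ → A) :
    substSeq τ (shiftPow k x) = shiftPow (p * k) (substSeq τ x) := by
  have h0 : (p : ℤ) ≠ 0 := by exact_mod_cast NeZero.ne p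
  funext n
  simp only [substSeq, shiftPow]
  rw [Int.add_mul_ediv_left _ _ h0, Int.add_mul_emod_self_left]

theorem substSeq_iterate_shiftPow (m : ℕ) (k : ℤ) (x : ℤ → A) :
    (substSeq τ)^[m] (shiftPow k x) = shiftPow (p ^ m * k) ((substSeq τ)^[m] x) := by
  induction m with
  | zero => simp
  | succ m ih =>
    rw [Function.iterate_succ_apply', ih, substSeq_shiftPow, Function.iterate_succ_apply']
    congr 1
    ring

/-- The block of `τ ^ m (x)` above coordinate `k` depends only on `x_k`. -/
theorem substSeq_iterate_congr {x y : ℤ → A} {k l : ℤ} (h : x k = y l) (m : ℕ) (i : ℤ)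
    (hi0 : 0 ≤ i) (hi : i < p ^ m) :
    (substSeq τ)^[m] x (p ^ m * k + i) = (substSeq τ)^[m] y (p ^ m * l + i) := by
  have h0 : (0 : ℤ) < p := by exact_mod_cast Nat.pos_of_ne_zero (NeZero.ne p)
  induction m generalizing i with
  | zero =>
    have : i = 0 := by simp at hi; omega
    subst this
    simpa using h
  | succ m ih =>
    simp only [Function.iterate_succ_apply']
    have e (c : ℤ) : (p : ℤ) ^ (m + 1) * c + i = i + p * (p ^ m * c) := by ring
    have hd : i / p < p ^ m := by
      rw [Int.ediv_lt_iff_lt_mul h0, ← pow_succ]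
      exact hi
    have := ih (i / p) (Int.ediv_nonneg hi0 h0.le) hd
    simp only [substSeq]
    rw [e k, e l, Int.add_mul_ediv_left _ _ h0.ne', Int.add_mul_emod_self_left,
      Int.add_mul_ediv_left _ _ h0.ne', Int.add_mul_emod_self_left, add_comm _ ((p : ℤ) ^ m * k),
      add_comm _ ((p : ℤ) ^ m * l), this]

/-- The word `τ ^ n (a)`, placed at the coordinates `0, …, p ^ n - 1` of a sequence. -/
def iterSeq (n : ℕ) (a : A) : ℤ → A := (substSeq τ)^[n] fun _ => a

theorem iterSeq_add (n m : ℕ) (b : A) (k i : ℤ) (hi0 : 0 ≤ i) (hi : i < p ^ n) :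
    iterSeq τ (n + m) b (p ^ n * k + i) = iterSeq τ n (iterSeq τ m b k) i := by
  have := substSeq_iterate_congr τ (x := iterSeq τ m b) (y := fun _ => iterSeq τ m b k)
    (k := k) (l := 0) rfl n i hi0 hi
  simpa only [iterSeq, Function.iterate_add_apply, mul_zero, zero_add] using this

theorem getElem_substWord (w : List A) (x : ℤ → A)
    (h : ∀ (i : ℕ) (hi : i < w.length), w[i] = x i) (i : ℕ) (hi : i < (substWord τ w).length) :
    (substWord τ w)[i] = substSeq τ x i := by
  induction w generalizing x i with
  | nil => simp [substWord] at hi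
  | cons a w ih =>
    have e : substWord τ (a :: w) = List.ofFn (τ a) ++ substWord τ w := by simp [substWord]
    simp only [e]
    by_cases hip : i < p
    · rw [List.getElem_append_left (by simpa using hip), List.getElem_ofFn]
      have := substSeq_mul_add τ x 0 i hip
      rw [mul_zero, zero_add] at this
      rw [this]
      have := h 0 (by simp)
      simp at this
      rw [this]
    · rw [List.getElem_append_right (by simpa using hip)]
      rw [ih (shiftPow 1 x) _ (i - (List.ofFn (τ a)).length), substSeq_shiftPow]
      · simp only [shiftPow, List.length_ofFn]
        congr 1
        omega
      · intro j hj
        have := h (j + 1) (by simpa using hj)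
        simpa [shiftPow] using this

theorem getElem_iterWord (n : ℕ) (a : A) (i : ℕ) (hi : i < (iterWord τ n a).length) :
    (iterWord τ n a)[i] = iterSeq τ n a i := by
  induction n generalizing i with
  | zero => simp [iterWord, iterSeq]
  | succ n ih =>
    have e : iterWord τ (n + 1) a = substWord τ (iterWord τ n a) :=
      Function.iterate_succ_apply' _ _ _
    simp only [e]
    rw [getElem_substWord τ _ (iterSeq τ n a) ih, iterSeq, iterSeq, Function.iterate_succ_apply']

theorem occurs_iterWord_iff (n : ℕ) (a : A) (x : ℤ → A) :
    Occurs (iterWord τ n a) x ↔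
      ∃ k : ℤ, ∀ i : ℤ, 0 ≤ i → i < p ^ n → x (k + i) = iterSeq τ n a i := by
  refine exists_congr fun k => ⟨fun h i hi0 hi => ?_, fun h i hi => ?_⟩
  · lift i to ℕ using hi0
    have hi' : i < (iterWord τ n a).length := by
      rw [length_iterWord]
      exact_mod_cast hi
    rw [h i hi', getElem_iterWord]
  · rw [getElem_iterWord]
    refine h i (by positivity) ?_
    rw [length_iterWord] at hi
    exact_mod_cast hi

theorem exists_iterSeq_eq_of_mem {n : ℕ} {a b : A} (h : a ∈ iterWord τ n b) :
    ∃ s : ℤ, 0 ≤ s ∧ s < p ^ n ∧ iterSeq τ n b s = a := by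
  obtain ⟨i, hi, rfl⟩ := List.getElem_of_mem h
  refine ⟨i, by positivity, ?_, (getElem_iterWord τ n b i hi).symm⟩
  rw [length_iterWord] at hi
  exact_mod_cast hi

/-- In a primitive substitution every word `τ ^ n (a)` occurs in some `τ ^ m (b)`, `m ≥ n + N`,
with arbitrarily large margins on both sides. -/
theorem exists_iterSeq_with_margin (hp : 2 ≤ p) {N : ℕ} (hN : ∀ a b : A, a ∈ iterWord τ N b)
    (n : ℕ) (a : A) (L : ℕ) :
    ∃ (m : ℕ) (b : A) (s : ℤ), (L : ℤ) ≤ s ∧ s + L ≤ p ^ m ∧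
      ∀ i : ℤ, 0 ≤ i → i < p ^ n → iterSeq τ m b (s + i) = iterSeq τ n a i := by
  -- The letter at coordinate `L` of a word of length `p ^ (2 * L + 1) > 2 * L` has `L` letters on
  -- either side; its image under `τ ^ N` contains `a`.
  obtain ⟨r, hr0, hr, hra⟩ :=
    exists_iterSeq_eq_of_mem τ (hN a (iterSeq τ (2 * L + 1) a L))
  refine ⟨n + (N + (2 * L + 1)), a, p ^ n * (p ^ N * L + r), ?_, ?_, fun i hi0 hi => ?_⟩
  · have h1 : (1 : ℤ) ≤ p ^ n := one_le_pow₀ (by omega)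
    have h2 : (1 : ℤ) ≤ p ^ N := one_le_pow₀ (by omega)
    have h3 : (L : ℤ) ≤ p ^ N * L := le_mul_of_one_le_left (by positivity) h2
    exact (le_add_of_le_of_nonneg h3 hr0).trans (le_mul_of_one_le_left (by positivity) h1)
  · have h1 : (1 : ℤ) ≤ p ^ n * p ^ N := by
      rw [← pow_add]
      exact one_le_pow₀ (by omega)
    have h2 : (2 * L + 1 : ℤ) ≤ p ^ (2 * L + 1) := by
      exact_mod_cast (Nat.lt_pow_self (n := 2 * L + 1) (by omega : 1 < p)).le
    have h3 : (L : ℤ) ≤ p ^ n * p ^ N * L := le_mul_of_one_le_left (by positivity) h1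
    have h4 : (p : ℤ) ^ n * r ≤ p ^ n * p ^ N := mul_le_mul_of_nonneg_left hr.le (by positivity)
    have h5 : (p : ℤ) ^ n * p ^ N * (2 * L + 1) ≤ p ^ n * p ^ N * p ^ (2 * L + 1) :=
      mul_le_mul_of_nonneg_left h2 (by positivity)
    rw [pow_add, pow_add, ← mul_assoc]
    linarith
  · rw [iterSeq_add τ n _ a _ i hi0 hi, iterSeq_add τ N _ a _ r hr0 hr, hra]

end Combinatorics

/-! ### Identification of `X_τ` with the shift of the language of `τ`. -/

section Language

variable [NeZero p] (τ : A → Fin p → A)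

/-- The sequences all of whose finite sub-words are sub-words of some `τ ^ n (a)`. -/
def langShift : Set (ℤ → A) :=
  {x | ∀ L : ℕ, ∃ (n : ℕ) (a : A) (s : ℤ), (L : ℤ) ≤ s ∧ s + L ≤ p ^ n ∧
    ∀ i : ℤ, -L ≤ i → i < L → x i = iterSeq τ n a (s + i)}

theorem shiftPow_mem_langShift {x : ℤ → A} (hx : x ∈ langShift τ) (k : ℤ) :
    shiftPow k x ∈ langShift τ := by
  intro L
  obtain ⟨n, a, s, h1, h2, h3⟩ := hx (L + k.natAbs)
  refine ⟨n, a, s + k, by rw [Nat.cast_add] at h1; omega, by rw [Nat.cast_add] at h2; omega,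
    fun i hi hi' => ?_⟩
  rw [shiftPow, h3 _ (by omega) (by omega)]
  congr 1
  ring

/-- Each point is a limit of shifts of points of any competing subshift, which is closed. -/
theorem langShift_subset_substShift [TopologicalSpace A] : langShift τ ⊆ substShift τ := by
  rintro x hx X ⟨hX, hw⟩
  rw [← hX.1.closure_eq, mem_closure_iff_nhds]
  intro U hU
  rw [nhds_pi, Filter.mem_pi] at hU
  obtain ⟨I, hI, t, ht, htU⟩ := hU
  obtain ⟨L, hL⟩ : ∃ L : ℕ, ∀ i ∈ I, -(L : ℤ) ≤ i ∧ i < L := by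
    obtain ⟨M, hM⟩ := (hI.image Int.natAbs).bddAbove
    refine ⟨M + 1, fun i hi => ?_⟩
    have := hM (Set.mem_image_of_mem _ hi)
    push_cast
    omega
  obtain ⟨n, a, s, h1, h2, h3⟩ := hx L
  obtain ⟨y, hy, hyo⟩ := hw n a
  obtain ⟨k, hk⟩ := (occurs_iterWord_iff τ n a y).1 hyo
  refine ⟨shiftPow (k + s) y, htU fun i hi => ?_, hX.shiftPow_mem hy _⟩
  obtain ⟨hi1, hi2⟩ := hL i hi
  have : shiftPow (k + s) y i = x i := by
    rw [h3 i hi1 hi2, ← hk (s + i) (by omega) (by omega), shiftPow]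
    congr 1
    ring
  rw [this]
  exact mem_of_mem_nhds (ht i)

variable [TopologicalSpace A] [DiscreteTopology A]

theorem isClosed_setOf_window [Finite A] (L : ℕ) (P : (ℤ → A) → Prop)
    (hP : ∀ x y : ℤ → A, (∀ i : ℤ, -L ≤ i → i < L → x i = y i) → P x → P y) :
    IsClosed {x | P x} := by
  let f : (ℤ → A) → (Finset.Ico (-L : ℤ) L → A) := fun x i => x i
  have hf : Continuous f := by fun_prop
  -- `f` restricts to a finite window, so its target is discrete.
  have : {x | P x} = f ⁻¹' (f '' {x | P x}) := by
    refine Set.Subset.antisymm (Set.subset_preimage_image _ _) ?_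
    rintro y ⟨x, hx, hxy⟩
    exact hP x y (fun i h1 h2 => congrFun hxy ⟨i, Finset.mem_Ico.2 ⟨h1, h2⟩⟩) hx
  rw [this]
  exact (isClosed_discrete _).preimage hf

theorem isClosed_window [Finite A] (L : ℕ) :
    IsClosed {x : ℤ → A | ∃ (n : ℕ) (a : A) (s : ℤ), (L : ℤ) ≤ s ∧ s + L ≤ p ^ n ∧
      ∀ i : ℤ, -L ≤ i → i < L → x i = iterSeq τ n a (s + i)} := by
  refine isClosed_setOf_window L _ ?_
  rintro x y hxy ⟨n, a, s, h1, h2, h3⟩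
  exact ⟨n, a, s, h1, h2, fun i hi hi' => (hxy i hi hi').symm.trans (h3 i hi hi')⟩

theorem isClosed_langShift [Finite A] : IsClosed (langShift τ) := by
  have : langShift τ = ⋂ L : ℕ, {x : ℤ → A | ∃ (n : ℕ) (a : A) (s : ℤ), (L : ℤ) ≤ s ∧
      s + L ≤ p ^ n ∧ ∀ i : ℤ, -L ≤ i → i < L → x i = iterSeq τ n a (s + i)} := by
    ext x
    simp [langShift]
  rw [this]
  exact isClosed_iInter fun L => isClosed_window τ L

/-- Every word `τ ^ n (a)` can be extended to a point of `langShift τ`. -/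
theorem exists_mem_langShift [Finite A] (hp : 2 ≤ p) (hprim : IsPrimitive τ) (n : ℕ) (a : A) :
    ∃ x ∈ langShift τ, ∀ i : ℤ, 0 ≤ i → i < p ^ n → x i = iterSeq τ n a i := by
  obtain ⟨N, hN⟩ := hprim
  -- Nested nonempty compact sets: the window that must lie in the language grows with `L`.
  let K : ℕ → Set (ℤ → A) := fun L =>
    {x | ∀ i : ℤ, 0 ≤ i → i < p ^ n → x i = iterSeq τ n a i} ∩
    {x | ∃ (m : ℕ) (b : A) (s : ℤ), (L : ℤ) ≤ s ∧ s + L ≤ p ^ m ∧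
      ∀ i : ℤ, -L ≤ i → i < L → x i = iterSeq τ m b (s + i)}
  have hcl (L : ℕ) : IsClosed (K L) := by
    refine IsClosed.inter (isClosed_setOf_window (p ^ n) _ ?_) (isClosed_window τ L)
    intro x y hxy hx i h0 h1
    rw [← hx i h0 h1]
    refine (hxy i ?_ (by exact_mod_cast h1)).symm
    exact le_trans (neg_nonpos.2 (by positivity)) h0
  have hne : (⋂ L, K L).Nonempty := by
    refine IsCompact.nonempty_iInter_of_sequence_nonempty_isCompact_isClosed K ?_ ?_
      (hcl 0).isCompact hcl
    · rintro L x ⟨hx, m, b, s, h1, h2, h3⟩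
      exact ⟨hx, m, b, s, by omega, by push_cast at h2; omega,
        fun i hi hi' => h3 i (by omega) (by omega)⟩
    · intro L
      obtain ⟨m, b, s, h1, h2, h3⟩ := exists_iterSeq_with_margin τ hp hN n a L
      exact ⟨fun i => iterSeq τ m b (s + i), h3, m, b, s, h1, h2, fun _ _ _ => rfl⟩
  obtain ⟨x, hx⟩ := hne
  rw [Set.mem_iInter] at hx
  exact ⟨x, fun L => (hx L).2, (hx 0).1⟩

theorem substShift_eq_langShift [Finite A] (hp : 2 ≤ p) (hprim : IsPrimitive τ) :
    substShift τ = langShift τ := by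
  refine Set.Subset.antisymm (fun x hx => hx _ ⟨?_, fun n a => ?_⟩)
    (langShift_subset_substShift τ)
  · exact isSubshift_of_shiftPow_mem (isClosed_langShift τ)
      fun x hx k => shiftPow_mem_langShift τ hx k
  · obtain ⟨x, hx, h⟩ := exists_mem_langShift τ hp hprim n a
    exact ⟨x, hx, (occurs_iterWord_iff τ n a x).2 ⟨0, by simpa using h⟩⟩

end Language

/-! ### Existence of addresses. -/

section Desubstitution

variable [NeZero p] (τ : A → Fin p → A) [TopologicalSpace A] [DiscreteTopology A]

theorem continuous_substSeq : Continuous (substSeq τ) :=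
  continuous_pi fun n =>
    (continuous_of_discreteTopology (f := fun a => τ a (Fin.ofNat p (n % p).toNat))).comp
      (continuous_apply (n / p))

theorem exists_desubstitution [Finite A] (hp : 2 ≤ p) (hprim : IsPrimitive τ)
    (hinf : (substShift τ).Infinite) (x : substShift τ) :
    ∃ (z : substShift τ) (d : Fin p), substSeq τ z.1 = shiftPow (-((d : ℕ) : ℤ)) x.1 := by
  have h0 : (0 : ℤ) < p := by omega
  have hL := substShift_eq_langShift τ hp hprim
  let Y : Set (ℤ → A) := ⋃ i : Fin p, (fun z => shiftPow (i : ℕ) (substSeq τ z)) '' langShift τ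
  have hmem (z : ℤ → A) (hz : z ∈ langShift τ) (k : ℤ) : shiftPow k (substSeq τ z) ∈ Y := by
    have h1 := Int.emod_nonneg k h0.ne'
    have h2 := Int.emod_lt_of_pos k h0
    refine Set.mem_iUnion.2 ⟨⟨(k % p).toNat, by omega⟩, shiftPow (k / p) z,
      shiftPow_mem_langShift τ hz _, ?_⟩
    dsimp only
    rw [substSeq_shiftPow, shiftPow_shiftPow, Int.toNat_of_nonneg h1, Int.emod_add_mul_ediv]
  have hY : IsSubshift Y := by
    refine isSubshift_of_shiftPow_mem ?_ ?_
    · exact isClosed_iUnion_of_finite fun i => ((isClosed_langShift τ).isCompact.image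
        ((continuous_shiftPow _).comp (continuous_substSeq τ))).isClosed
    · intro y hy k
      obtain ⟨i, z, hz, rfl⟩ := Set.mem_iUnion.1 hy
      dsimp only
      rw [shiftPow_shiftPow]
      exact hmem z hz _
  have hw (n : ℕ) (a : A) : AppearsIn (iterWord τ n a) Y := by
    have hprim' := hprim
    obtain ⟨N, hN⟩ := hprim
    -- A positive exponent leaves one `τ` to peel off, placing the word in a `τ`-image; exponent `0`
    -- would force a single letter, hence a finite `X_τ`.
    obtain ⟨N, rfl⟩ : ∃ M, N = M + 1 := by
      refine Nat.exists_eq_succ_of_ne_zero ?_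
      rintro rfl
      have : Subsingleton A := ⟨fun a b => by simpa [iterWord] using hN a b⟩
      exact hinf (Set.toFinite _)
    obtain ⟨s, hs0, hs, hsa⟩ := exists_iterSeq_eq_of_mem τ (hN a a)
    obtain ⟨z, hz, hzw⟩ := exists_mem_langShift τ hp hprim' (n + N) a
    refine ⟨substSeq τ z, by simpa [shiftPow_zero] using hmem z hz 0, ?_⟩
    rw [occurs_iterWord_iff]
    refine ⟨p ^ n * s, fun i hi0 hi => ?_⟩
    have hj0 : 0 ≤ p ^ n * s + i := by positivity
    have hj : p ^ n * s + i < p ^ (n + N + 1) := by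
      have : (p : ℤ) ^ n * (s + 1) ≤ p ^ n * p ^ (N + 1) :=
        mul_le_mul_of_nonneg_left (by omega) (by positivity)
      rw [add_assoc, pow_add]
      linarith
    have hd : (p ^ n * s + i) / p < (p : ℤ) ^ (n + N) := by
      rwa [Int.ediv_lt_iff_lt_mul h0, ← pow_succ]
    rw [← hsa, ← iterSeq_add τ n (N + 1) a s i hi0 hi, iterSeq, ← add_assoc,
      Function.iterate_succ_apply', substSeq, substSeq,
      hzw _ (Int.ediv_nonneg hj0 h0.le) hd, iterSeq]
  obtain ⟨i, z, hz, hzx⟩ := Set.mem_iUnion.1 (x.2 Y ⟨hY, hw⟩)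
  refine ⟨⟨z, hL ▸ hz⟩, i, ?_⟩
  rw [← hzx]
  dsimp only
  rw [shiftPow_shiftPow, neg_add_cancel, shiftPow_zero]

theorem exists_isAddress [Finite A] (hp : 2 ≤ p) (hprim : IsPrimitive τ)
    (hinf : (substShift τ).Infinite) (x : substShift τ) : ∃ δ, IsAddress τ x δ := by
  choose z d h using exists_desubstitution τ hp hprim hinf
  refine ⟨fun i => d (z^[i] x), fun i => z^[i] x, rfl, fun i => ?_⟩
  simp only [Function.iterate_succ_apply']
  exact h _

theorem isAddress_odometerMap [Finite A] (hp : 2 ≤ p) (hprim : IsPrimitive τ)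
    (hinf : (substShift τ).Infinite) (x : substShift τ) : IsAddress τ x (odometerMap τ x) :=
  Classical.epsilon_spec (exists_isAddress τ hp hprim hinf x)

end Desubstitution

/-! ### From equal addresses to long common blocks. -/

section Coincidence

variable [NeZero p] (τ : A → Fin p → A)

/-- The shift is `∑ i < m, p ^ i * δ i`, which depends on the address alone. -/
theorem exists_common_desubstitution [TopologicalSpace A] {x y : substShift τ} {δ : ℕ → Fin p}
    (hx : IsAddress τ x δ) (hy : IsAddress τ y δ) (m : ℕ) :
    ∃ (D : ℤ) (u v : ℤ → A), x.1 = shiftPow D ((substSeq τ)^[m] u) ∧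
      y.1 = shiftPow D ((substSeq τ)^[m] v) := by
  obtain ⟨u, rfl, hu⟩ := hx
  obtain ⟨v, rfl, hv⟩ := hy
  have key (w : ℕ → substShift τ)
      (hw : ∀ i, substSeq τ (w (i + 1)).1 = shiftPow (-((δ i : ℕ) : ℤ)) (w i).1) :
      (w 0).1 = shiftPow (∑ i ∈ Finset.range m, (p : ℤ) ^ i * (δ i : ℕ))
        ((substSeq τ)^[m] (w m).1) := by
    induction m with
    | zero => simp [shiftPow_zero]
    | succ m ih =>
      have : (w m).1 = shiftPow (δ m : ℕ) (substSeq τ (w (m + 1)).1) := by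
        rw [hw, shiftPow_shiftPow, add_neg_cancel, shiftPow_zero]
      rw [ih, this, substSeq_iterate_shiftPow, shiftPow_shiftPow, Finset.sum_range_succ,
        Function.iterate_succ_apply]
  exact ⟨_, _, _, key u hu, key v hv⟩

/-- Two points with the same address agree on arbitrarily long blocks, arbitrarily far to the
right. -/
theorem exists_long_coincidence [TopologicalSpace A] (hcoin : HasOverallCoincidences τ)
    {x y : substShift τ} {δ : ℕ → Fin p} (hx : IsAddress τ x δ) (hy : IsAddress τ y δ)
    (m : ℕ) (N : ℤ) :
    ∃ s : ℤ, N ≤ s ∧ ∀ i : ℤ, 0 ≤ i → i < p ^ m → x.1 (s + i) = y.1 (s + i) := by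
  obtain ⟨D, u, v, hu, hv⟩ := exists_common_desubstitution τ hx hy (m + 1)
  have h0 : (1 : ℤ) ≤ p := by exact_mod_cast Nat.one_le_iff_ne_zero.2 (NeZero.ne p)
  -- Nonnegative and at least `N + D`, so inflating by `p ^ m` and undoing the shift by `D` stays
  -- right of `N`.
  let k : ℤ := |N + D|
  obtain ⟨j, hj⟩ := hcoin (u k) (v k)
  have hc : substSeq τ u (p * k + (j : ℕ)) = substSeq τ v (p * k + (j : ℕ)) := by
    rw [substSeq_mul_add τ u k j j.2, substSeq_mul_add τ v k j j.2]
    exact hj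
  refine ⟨p ^ m * (p * k + (j : ℕ)) - D, ?_, fun i hi0 hi => ?_⟩
  · have hk : 0 ≤ k := abs_nonneg _
    have h1 : k ≤ p * k := le_mul_of_one_le_left hk h0
    have h2 : p * k + (j : ℕ) ≤ (p : ℤ) ^ m * (p * k + (j : ℕ)) :=
      le_mul_of_one_le_left (by positivity) (one_le_pow₀ h0)
    have h3 : N + D ≤ k := le_abs_self _
    have h4 : (0 : ℤ) ≤ (j : ℕ) := by positivity
    linarith
  · have := substSeq_iterate_congr τ hc m i hi0 hi
    rw [hu, hv]
    simp only [shiftPow, Function.iterate_succ_apply]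
    convert this using 2 <;> ring

end Coincidence

/-! ### Compactness and the lower limit of distances. -/

section Proximality

/-- Small distances are detected by any decreasing sequence of closed relations with
intersection the diagonal. -/
theorem exists_forall_mem_dist_lt {X : Type*} [MetricSpace X] [CompactSpace X]
    {E : ℕ → Set (X × X)} (hE : Antitone E) (hcl : ∀ n, IsClosed (E n))
    (hdiag : ∀ q, (∀ n, q ∈ E n) → q.1 = q.2) {ε : ℝ} (hε : 0 < ε) :
    ∃ n, ∀ q ∈ E n, dist q.1 q.2 < ε := by
  have hS : IsClosed {q : X × X | ε ≤ dist q.1 q.2} :=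
    isClosed_le continuous_const continuous_dist
  obtain ⟨n, hn⟩ := hS.isCompact.elim_directed_family_closed E hcl (by
    refine Set.eq_empty_of_forall_notMem fun q hq => ?_
    have h1 : ε ≤ dist q.1 q.2 := hq.1
    rw [hdiag q (Set.mem_iInter.1 hq.2), dist_self] at h1
    exact absurd hε h1.not_gt) hE.directed_ge
  refine ⟨n, fun q hq => lt_of_not_ge fun h => ?_⟩
  exact (Set.eq_empty_iff_forall_notMem.1 hn q) ⟨h, hq⟩

theorem isProximalPair_of_frequently_lt {X : Type*} [MetricSpace X] {T : X → X} {x y : X}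
    (h : ∀ ε > 0, ∃ᶠ n in atTop, dist (T^[n] x) (T^[n] y) < ε) : IsProximalPair dist T x y := by
  have hbdd : IsBoundedUnder (· ≥ ·) atTop fun n => dist (T^[n] x) (T^[n] y) :=
    isBoundedUnder_of ⟨0, fun n => dist_nonneg⟩
  refine le_antisymm (le_of_forall_pos_le_add fun ε hε => ?_) ?_
  · rw [zero_add]
    exact liminf_le_of_frequently_le ((h ε hε).mono fun n hn => hn.le) hbdd
  · exact le_liminf_of_le
      (IsCoboundedUnder.of_frequently_le ((h 1 one_pos).mono fun n hn => hn.le))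
      (Eventually.of_forall fun n => dist_nonneg)

theorem coe_shiftOn_iterate [TopologicalSpace A] (τ : A → Fin p → A) (n : ℕ)
    (x : substShift τ) : ((shiftOn τ)^[n] x).1 = shiftPow n x.1 := by
  rw [← shift_iterate]
  exact (Function.Semiconj.iterate_right (f := Subtype.val) (fun _ => rfl) n).eq x

theorem isCompact_substShift [Finite A] [TopologicalSpace A] (τ : A → Fin p → A) :
    IsCompact (substShift τ) :=
  (isClosed_sInter fun _ hX => hX.1.1).isCompact

end Proximality

end ConstSubst

theorem proposition3p3 {A : Type*} [Finite A] [TopologicalSpace A] [DiscreteTopology A]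
    {p : ℕ} [NeZero p] (hp : 2 ≤ p) (τ : A → Fin p → A)
    (hprim : ConstSubst.IsPrimitive τ)
    (hinf : (ConstSubst.substShift τ).Infinite)
    (hcoin : ConstSubst.HasOverallCoincidences τ)
    (ρ : MetricSpace (ConstSubst.substShift τ))
    (hρ : ρ.toUniformSpace.toTopologicalSpace =
      (instTopologicalSpaceSubtype : TopologicalSpace (ConstSubst.substShift τ)))
    (x y : ConstSubst.substShift τ) (hxy : x ≠ y)
    (hπ : ConstSubst.odometerMap τ x = ConstSubst.odometerMap τ y) :
    ConstSubst.IsProximalPair ρ.dist (ConstSubst.shiftOn τ) x y := by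
  have hx := ConstSubst.isAddress_odometerMap τ hp hprim hinf x
  have hy := ConstSubst.isAddress_odometerMap τ hp hprim hinf y
  rw [← hπ] at hy
  have : CompactSpace (ConstSubst.substShift τ) :=
    isCompact_iff_compactSpace.1 (ConstSubst.isCompact_substShift τ)
  -- Same distance, but with the subspace topology as its definitional topology.
  let _ := ρ.replaceTopology hρ.symm
  refine ConstSubst.isProximalPair_of_frequently_lt fun ε hε => ?_
  let E : ℕ → Set (ConstSubst.substShift τ × ConstSubst.substShift τ) := fun L =>
    {q | ∀ i : ℤ, -L ≤ i → i < L → q.1.1 i = q.2.1 i}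
  obtain ⟨L, hL⟩ := ConstSubst.exists_forall_mem_dist_lt (E := E)
    (fun L M hLM q hq i h1 h2 => hq i (by omega) (by omega))
    (fun L => by
      simp only [E, Set.ofPred_forall]
      refine isClosed_iInter fun i => isClosed_iInter fun _ => isClosed_iInter fun _ => ?_
      exact isClosed_eq ((continuous_apply i).comp (continuous_subtype_val.comp continuous_fst))
        ((continuous_apply i).comp (continuous_subtype_val.comp continuous_snd)))
    (fun q hq => Subtype.ext (funext fun i => hq (i.natAbs + 1) i (by omega) (by omega))) hε
  rw [Filter.frequently_atTop]
  intro N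
  -- A block of length `p ^ (2 * L) > 2 * L` starting at `s` covers the window of radius `L` about
  -- `s + L`.
  obtain ⟨s, hs, hsxy⟩ := ConstSubst.exists_long_coincidence τ hcoin hx hy (2 * L) N
  have hpow : (2 * L : ℤ) < p ^ (2 * L) := by
    exact_mod_cast Nat.lt_pow_self (n := 2 * L) (by omega : 1 < p)
  lift s to ℕ using by omega
  refine ⟨s + L, by omega, hL (_, _) fun i h1 h2 => ?_⟩
  rw [ConstSubst.coe_shiftOn_iterate, ConstSubst.coe_shiftOn_iterate]
  have := hsxy (L + i) (by omega) (by omega)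
  simp only [ConstSubst.shiftPow]
  convert this using 2 <;> push_cast <;> ring
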